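/- Let $m\ge 0$ and $n\ge 3m$ be integers, let $\Omega$ be a set with $n$ elements, and let $J(n,m,m+1)$ be the graph whose vertex set $X$ consists of all $m$-subsets and all $(m+1)$-subsets of $\Omega$, an $m$-subset $y$ and an $(m+1)$-subset $z$ being adjacent if and only if $y\subseteq z$ (there are no other edges). Fix a vertex $x\in X$ that is an $m$-subset of $\Omega$. Let $\partial$ denote the graph distance and put $D(x)=\max_{y\in X}\partial(x,y)$. For $0\le i\le D(x)$ let $E_i^*\in \mathrm{Mat}_X(\mathbb{C})$ be the diagonal matrix whose $yy$-entry is $1$ if $\partial(x,y)=i$ and $0$ otherwise. Let $\mathcal{T}(x)$ be the subalgebra of $\mathrm{Mat}_X(\mathbb{C})$ generated by the adjacency matrix of $J(n,m,m+1)$ and $E_0^*,\dots,E_{D(x)}^*$. A $\mathcal{T}(x)$-module is a subspace $W\subseteq\mathbb{C}^X$ with $\mathcal{T}(x)W\subseteq W$; it is irreducible if it is nonzero and does not properly contain a nonzero $\mathcal{T}(x)$-module. Then $J(n,m,m+1)$ is thin with respect to $x$: every irreducible $\mathcal{T}(x)$-module $W$ satisfies $\dim E_i^*W\le 1$ for all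 $0\le i\le D(x)$. -/

import Mathlib

namespace Terwilliger

section General

variable {X : Type*} [Fintype X] [DecidableEq X]

/-- The diameter `D(x)` of a finite connected graph with respect to `x`:
the maximum of the distances `∂(x, y)`, `y ∈ X`. -/
noncomputable def diam (G : SimpleGraph X) (x : X) : ℕ :=
  Finset.univ.sup fun y => G.dist x y

/-- The dual idempotent `E_i^* = E_i^*(x)`: the diagonal matrix whose `yy`-entry is `1` if
`∂(x, y) = i` and `0` otherwise. -/
noncomputable def dualIdempotent (G : SimpleGraph X) (x : X) (i : ℕ) : Matrix X X ℂ :=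
  Matrix.diagonal fun y => if G.dist x y = i then 1 else 0

/-- The Terwilliger algebra `T(x)`: the subalgebra of `Mat_X(ℂ)` generated by the adjacency
matrix and the matrices `E_0^*, …, E_{D(x)}^*`. -/
noncomputable def terwilligerAlgebra (G : SimpleGraph X) [DecidableRel G.Adj] (x : X) :
    Subalgebra ℂ (Matrix X X ℂ) :=
  Algebra.adjoin ℂ
    ({G.adjMatrix ℂ} ∪ {M | ∃ i, i ≤ diam G x ∧ M = dualIdempotent G x i})

/-- `W ⊆ V = ℂ^X` is a `T(x)`-module: `T(x) W ⊆ W`. -/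
def IsTModule (G : SimpleGraph X) [DecidableRel G.Adj] (x : X)
    (W : Submodule ℂ (X → ℂ)) : Prop :=
  ∀ M ∈ terwilligerAlgebra G x, ∀ v ∈ W, M.mulVec v ∈ W

/-- `W` is an irreducible `T(x)`-module: it is a nonzero `T(x)`-module that does not properly
contain a nonzero `T(x)`-module. -/
def IsIrreducibleTModule (G : SimpleGraph X) [DecidableRel G.Adj] (x : X)
    (W : Submodule ℂ (X → ℂ)) : Prop :=
  IsTModule G x W ∧ W ≠ ⊥ ∧
    ∀ U : Submodule ℂ (X → ℂ), IsTModule G x U → U ≠ ⊥ → ¬ U < W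

/-- `W` is thin: `dim E_i^* W ≤ 1` for every `i ∈ {0, …, D(x)}`. -/
def IsThinTModule (G : SimpleGraph X) (x : X) (W : Submodule ℂ (X → ℂ)) : Prop :=
  ∀ i, i ≤ diam G x →
    Module.finrank ℂ (W.map (dualIdempotent G x i).mulVecLin) ≤ 1

/-- The graph is thin with respect to `x`: every irreducible `T(x)`-module is thin. -/
def IsThinWithRespectTo (G : SimpleGraph X) [DecidableRel G.Adj] (x : X) : Prop :=
  ∀ W : Submodule ℂ (X → ℂ), IsIrreducibleTModule G x W → IsThinTModule G x W

end General

section Johnson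

/-- The `m`-subsets and the `(m+1)`-subsets of `Ω`. -/
abbrev JohnsonVertex (Ω : Type*) (m : ℕ) : Type _ :=
  {s : Finset Ω // s.card = m ∨ s.card = m + 1}

/-- The incidence graph `J(n, m, m+1)` of the Johnson geometry on the set `Ω` (of size `n`):
an `m`-subset `y` and an `(m+1)`-subset `z` are adjacent if and only if `y ⊆ z`, and there are
no further edges. -/
def johnsonIncidenceGraph (Ω : Type*) (m : ℕ) : SimpleGraph (JohnsonVertex Ω m) where
  Adj y z :=
    (y.1.card = m ∧ z.1.card = m + 1 ∧ y.1 ⊆ z.1) ∨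
      (z.1.card = m ∧ y.1.card = m + 1 ∧ z.1 ⊆ y.1)
  symm := ⟨fun _ _ h => h.symm⟩
  loopless := ⟨fun y h => by omega⟩

instance johnsonIncidenceGraph.decidableAdj (Ω : Type*) [DecidableEq Ω] (m : ℕ) :
    DecidableRel (johnsonIncidenceGraph Ω m).Adj := fun y z =>
  inferInstanceAs (Decidable
    ((y.1.card = m ∧ z.1.card = m + 1 ∧ y.1 ⊆ z.1) ∨
      (z.1.card = m ∧ y.1.card = m + 1 ∧ z.1 ⊆ y.1)))

end Johnson

end Terwilliger

namespace Terwilliger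

/-! ### Automorphisms fixing the base vertex and thinness, for an arbitrary finite graph. -/

section General

variable {X : Type*} [Fintype X] [DecidableEq X]

/-! Matrices in `T(x)` are invariant under the automorphisms fixing `x`. If any two vertices at
equal distance from `x` can be interchanged by such an automorphism, every matrix in `E_i^* T E_i^*`
is symmetric. A product-closed family of symmetric matrices commutes, since `AB = (AB)ᵀ = BA`; and
on `E_i^* W`, with `W` irreducible, a commuting family that carries each nonzero vector to every
other has dimension at most one over `ℂ`.

In the Johnson geometry `∂(x, y) = 2|x \ y| + (|y| - m)` (`johnsonIncidenceGraph_dist`), so equal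
distances mean equal sizes and equal intersections with `x`. A permutation of `Ω` then stabilizes
`x` and interchanges the two sets (`exists_perm_stabilizing`). -/

theorem dist_apply_iso (G : SimpleGraph X) (φ : G ≃g G) (y z : X) :
    G.dist (φ y) (φ z) = G.dist y z := by
  have key : ∀ (ψ : G ≃g G) (y z : X), G.Reachable y z → G.dist (ψ y) (ψ z) ≤ G.dist y z := by
    intro ψ y z h
    obtain ⟨p, hp⟩ := h.exists_walk_length_eq_dist
    rw [← hp, ← SimpleGraph.Walk.length_map ψ.toHom p]
    exact SimpleGraph.dist_le _
  by_cases h : G.Reachable y z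
  · refine le_antisymm (key φ y z h) ?_
    have h2 := key φ.symm (φ y) (φ z) (h.map φ.toHom)
    simpa using h2
  -- Distance is `0` by convention between unreachable vertices, so unreachability must be
  -- transported as well.
  · have h2 : ¬ G.Reachable (φ y) (φ z) := fun hr => h (by
      simpa using hr.map φ.symm.toHom)
    rw [SimpleGraph.dist_eq_zero_of_not_reachable h, SimpleGraph.dist_eq_zero_of_not_reachable h2]

/-- An automorphism fixing `x` preserves adjacency and distance to `x`, hence the generators;
invariance passes to sums and products. -/
theorem terwilligerAlgebra_apply_iso (G : SimpleGraph X) [DecidableRel G.Adj] (x : X)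
    (φ : G ≃g G) (hφ : φ x = x) {M : Matrix X X ℂ} (hM : M ∈ terwilligerAlgebra G x) (y z : X) :
    M (φ y) (φ z) = M y z := by
  induction hM using Algebra.adjoin_induction generalizing y z with
  | mem M hM =>
    rcases hM with rfl | ⟨i, -, rfl⟩
    · simp only [SimpleGraph.adjMatrix_apply, φ.map_adj_iff]
    · have h : G.dist x (φ y) = G.dist x y := by
        conv_lhs => rw [← hφ]
        exact dist_apply_iso G φ x y
      simp only [dualIdempotent, Matrix.diagonal_apply, h, φ.injective.eq_iff]
  | algebraMap r => simp only [Matrix.algebraMap_matrix_apply, φ.injective.eq_iff]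
  | add a b _ _ ha hb => simp only [Matrix.add_apply, ha, hb]
  | mul a b _ _ ha hb =>
    simp only [Matrix.mul_apply]
    rw [← Equiv.sum_comp φ.toEquiv]
    exact Finset.sum_congr rfl fun w _ => congrArg₂ (· * ·) (ha y w) (hb w z)

theorem dualIdempotent_mul_mul_apply (G : SimpleGraph X) (x : X) (i : ℕ) (M : Matrix X X ℂ)
    (y z : X) : (dualIdempotent G x i * M * dualIdempotent G x i) y z =
      if G.dist x y = i ∧ G.dist x z = i then M y z else 0 := by
  simp only [dualIdempotent, Matrix.mul_diagonal, Matrix.diagonal_mul]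
  split_ifs <;> simp_all

theorem dualIdempotent_mul_self (G : SimpleGraph X) (x : X) (i : ℕ) :
    dualIdempotent G x i * dualIdempotent G x i = dualIdempotent G x i := by
  simp [dualIdempotent, Matrix.diagonal_mul_diagonal]

theorem dualIdempotent_mem (G : SimpleGraph X) [DecidableRel G.Adj] (x : X) {i : ℕ}
    (hi : i ≤ diam G x) : dualIdempotent G x i ∈ terwilligerAlgebra G x :=
  Algebra.subset_adjoin (Or.inr ⟨i, hi, rfl⟩)

/-- A nonzero vector of an irreducible module generates it. -/
theorem IsIrreducibleTModule.exists_mulVec_eq {G : SimpleGraph X} [DecidableRel G.Adj] {x : X}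
    {W : Submodule ℂ (X → ℂ)} (hW : IsIrreducibleTModule G x W) {w : X → ℂ} (hw : w ∈ W)
    (hw0 : w ≠ 0) {v : X → ℂ} (hv : v ∈ W) :
    ∃ M ∈ terwilligerAlgebra G x, M.mulVec w = v := by
  let U : Submodule ℂ (X → ℂ) :=
    { carrier := {u | ∃ M ∈ terwilligerAlgebra G x, M.mulVec w = u}
      add_mem' := by
        rintro _ _ ⟨M, hM, rfl⟩ ⟨N, hN, rfl⟩
        exact ⟨M + N, add_mem hM hN, Matrix.add_mulVec _ _ _⟩
      zero_mem' := ⟨0, zero_mem _, Matrix.zero_mulVec _⟩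
      smul_mem' := by
        rintro c _ ⟨M, hM, rfl⟩
        exact ⟨c • M, Subalgebra.smul_mem _ hM c, Matrix.smul_mulVec _ _ _⟩ }
  have hUW : U ≤ W := by
    rintro _ ⟨M, hM, rfl⟩
    exact hW.1 M hM w hw
  have hwU : w ∈ U := ⟨1, one_mem _, Matrix.one_mulVec w⟩
  have hU : IsTModule G x U := by
    rintro M hM _ ⟨N, hN, rfl⟩
    exact ⟨M * N, mul_mem hM hN, (Matrix.mulVec_mulVec _ _ _).symm⟩
  have hU0 : U ≠ ⊥ := fun h => hw0 (by rw [h] at hwU; simpa using hwU)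
  have : U = W := by
    by_contra hne
    exact hW.2.2 U hU hU0 (lt_of_le_of_ne hUW hne)
  rw [← this] at hv
  exact hv

/-- The graph is thin with respect to `x` as soon as each algebra `E_i^* T E_i^*` is commutative. -/
theorem isThinWithRespectTo_of_commute (G : SimpleGraph X) [DecidableRel G.Adj] (x : X)
    (h : ∀ i ≤ diam G x, ∀ M ∈ terwilligerAlgebra G x, ∀ N ∈ terwilligerAlgebra G x,
      Commute (dualIdempotent G x i * M * dualIdempotent G x i)
        (dualIdempotent G x i * N * dualIdempotent G x i)) :
    IsThinWithRespectTo G x := by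
  intro W hW i hi
  have hEmem := dualIdempotent_mem G x hi
  have hcomm := h i hi
  have hidem := dualIdempotent_mul_self G x i
  generalize dualIdempotent G x i = E at hEmem hcomm hidem ⊢
  set F : Submodule ℂ (X → ℂ) := W.map E.mulVecLin with hF
  have hFW : F ≤ W := by
    rintro _ ⟨u, hu, rfl⟩
    exact hW.1 E hEmem u hu
  have hEF : ∀ v ∈ F, E.mulVec v = v := by
    rintro _ ⟨u, hu, rfl⟩
    simp [Matrix.mulVec_mulVec, hidem]
  have hmaps : ∀ M ∈ terwilligerAlgebra G x, ∀ v ∈ F, (E * M * E).mulVecLin v ∈ F := by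
    intro M hM v hv
    refine ⟨M.mulVec v, hW.1 M hM v (hFW hv), ?_⟩
    simp only [Matrix.mulVecLin_apply, ← Matrix.mulVec_mulVec, hEF v hv]
  have hgen : ∀ w ∈ F, w ≠ 0 → ∀ v ∈ F, ∃ M ∈ terwilligerAlgebra G x,
      (E * M * E).mulVec w = v := by
    intro w hw hw0 v hv
    obtain ⟨M, hM, hMw⟩ := hW.exists_mulVec_eq (hFW hw) hw0 (hFW hv)
    refine ⟨M, hM, ?_⟩
    rw [← Matrix.mulVec_mulVec, ← Matrix.mulVec_mulVec, hEF w hw, hMw, hEF v hv]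
  by_cases hF0 : F = ⊥
  · rw [hF0, finrank_bot]
    exact zero_le_one
  obtain ⟨w, hw, hw0⟩ := F.ne_bot_iff.1 hF0
  refine finrank_le_one (⟨w, hw⟩ : F) ?_
  rintro ⟨v, hv⟩
  obtain ⟨M, hM, rfl⟩ := hgen w hw hw0 v hv
  have : Nontrivial F := ⟨⟨⟨w, hw⟩, 0, fun h => hw0 (congrArg Subtype.val h)⟩⟩
  -- An eigenvector `u` of `E M E` generates `w` as `w = (E N E) u`; commutation then makes `w` an
  -- eigenvector with the same eigenvalue.
  obtain ⟨c, hc⟩ := Module.End.exists_eigenvalue ((E * M * E).mulVecLin.restrict (hmaps M hM))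
  obtain ⟨⟨u, hu⟩, hu'⟩ := hc.exists_hasEigenvector
  have hu0 : u ≠ 0 := fun h => hu'.2 (Subtype.ext h)
  have huc : (E * M * E).mulVec u = c • u := congrArg Subtype.val hu'.apply_eq_smul
  obtain ⟨N, hN, hNu⟩ := hgen u hu hu0 w hw
  refine ⟨c, Subtype.ext ?_⟩
  change c • w = (E * M * E).mulVec w
  rw [← hNu, Matrix.mulVec_mulVec, (hcomm M hM N hN).eq,
    ← Matrix.mulVec_mulVec u (E * N * E) (E * M * E), huc, Matrix.mulVec_smul]

/-- If any two vertices at the same distance from `x` are interchanged by an automorphism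
fixing `x`, then the graph is thin with respect to `x`. -/
theorem isThinWithRespectTo_of_exists_iso (G : SimpleGraph X) [DecidableRel G.Adj] (x : X)
    (h : ∀ y z, G.dist x y = G.dist x z → ∃ φ : G ≃g G, φ x = x ∧ φ y = z ∧ φ z = y) :
    IsThinWithRespectTo G x := by
  refine isThinWithRespectTo_of_commute G x fun i hi M hM N hN => ?_
  have hsymm : ∀ K ∈ terwilligerAlgebra G x,
      (dualIdempotent G x i * K * dualIdempotent G x i).transpose =
        dualIdempotent G x i * K * dualIdempotent G x i := by
    intro K hK
    ext y z
    rw [Matrix.transpose_apply, dualIdempotent_mul_mul_apply, dualIdempotent_mul_mul_apply]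
    by_cases hyz : G.dist x y = i ∧ G.dist x z = i
    · rw [if_pos hyz, if_pos hyz.symm]
      obtain ⟨φ, hx, hy, hz⟩ := h y z (hyz.1.trans hyz.2.symm)
      rw [← terwilligerAlgebra_apply_iso G x φ hx hK y z, hy, hz]
    · rw [if_neg hyz, if_neg fun h' => hyz h'.symm]
  have hE := dualIdempotent_mem G x hi
  -- Sandwiching this element of the algebra gives the product of the two blocks, which is therefore
  -- symmetric.
  have hMN := hsymm (M * dualIdempotent G x i * (dualIdempotent G x i * N))
    (mul_mem (mul_mem hM hE) (mul_mem hE hN))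
  have hprod : dualIdempotent G x i * (M * dualIdempotent G x i * (dualIdempotent G x i * N)) *
      dualIdempotent G x i = (dualIdempotent G x i * M * dualIdempotent G x i) *
        (dualIdempotent G x i * N * dualIdempotent G x i) := by
    simp only [Matrix.mul_assoc]
  rw [hprod, Matrix.transpose_mul, hsymm M hM, hsymm N hN] at hMN
  exact hMN.symm

end General

/-! ### Permutations interchanging two finite sets. -/

section Permutations

variable {Ω : Type*}

theorem map_eq_of_forall_mem (σ : Equiv.Perm Ω) {s t : Finset Ω} (h : ∀ a ∈ s, σ a ∈ t)
    (hc : s.card = t.card) : s.map σ.toEmbedding = t := by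
  refine Finset.eq_of_subset_of_card_le ?_ (by rw [Finset.card_map, hc])
  intro b hb
  obtain ⟨a, ha, rfl⟩ := Finset.mem_map.1 hb
  exact h a ha

variable [DecidableEq Ω]

/-- Two disjoint finite sets of the same size are interchanged by an involution fixing all
other points. -/
theorem exists_perm_interchange {A B : Finset Ω} (hAB : Disjoint A B) (hc : A.card = B.card) :
    ∃ σ : Equiv.Perm Ω, (∀ a ∈ A, σ a ∈ B) ∧ (∀ b ∈ B, σ b ∈ A) ∧
      ∀ c, c ∉ A → c ∉ B → σ c = c := by
  let e : A ≃ B := Finset.equivOfCardEq hc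
  let f : Ω → Ω := fun a =>
    if h : a ∈ A then e ⟨a, h⟩ else if h : a ∈ B then e.symm ⟨a, h⟩ else a
  have hB : ∀ b ∈ B, b ∉ A := fun b hb ha => Finset.disjoint_left.1 hAB ha hb
  have fA : ∀ a (h : a ∈ A), f a = e ⟨a, h⟩ := fun a h => dif_pos h
  have fB : ∀ b (h : b ∈ B), f b = e.symm ⟨b, h⟩ := fun b h =>
    (dif_neg (hB b h)).trans (dif_pos h)
  have fC : ∀ c, c ∉ A → c ∉ B → f c = c := fun c h h' => (dif_neg h).trans (dif_neg h')
  have hf : Function.Involutive f := by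
    intro a
    by_cases hA : a ∈ A
    · rw [fA a hA, fB _ (e ⟨a, hA⟩).2]; simp
    · by_cases hB' : a ∈ B
      · rw [fB a hB', fA _ (e.symm ⟨a, hB'⟩).2]; simp
      · rw [fC a hA hB', fC a hA hB']
  refine ⟨hf.toPerm, fun a ha => ?_, fun b hb => ?_, fC⟩
  · change f a ∈ B
    rw [fA a ha]; exact (e ⟨a, ha⟩).2
  · change f b ∈ A
    rw [fB b hb]; exact (e.symm ⟨b, hb⟩).2

theorem card_sdiff_eq_card_sdiff {s t : Finset Ω} (h : s.card = t.card) :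
    (s \ t).card = (t \ s).card := by
  have h1 := Finset.card_sdiff_add_card_inter s t
  have h2 := Finset.card_sdiff_add_card_inter t s
  rw [Finset.inter_comm] at h2
  omega

/-- Two finite sets of the same size that meet `s` in equally many points are interchanged by a
permutation that stabilizes `s`. -/
theorem exists_perm_stabilizing {s y z : Finset Ω} (hc : y.card = z.card)
    (hs : (s \ y).card = (s \ z).card) :
    ∃ σ : Equiv.Perm Ω, s.map σ.toEmbedding = s ∧ y.map σ.toEmbedding = z ∧
      z.map σ.toEmbedding = y := by
  have hin : (y ∩ s).card = (z ∩ s).card := by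
    have h1 := Finset.card_sdiff_add_card_inter s y
    have h2 := Finset.card_sdiff_add_card_inter s z
    rw [Finset.inter_comm] at h1 h2
    omega
  have hout : (y \ s).card = (z \ s).card := by
    have h1 := Finset.card_sdiff_add_card_inter y s
    have h2 := Finset.card_sdiff_add_card_inter z s
    omega
  -- `σ` swaps the differences of `y` and `z` inside `s`, and `τ` those outside; points of `y ∩ z`
  -- stay fixed.
  obtain ⟨σ, h1, h2, h3⟩ := exists_perm_interchange (disjoint_sdiff_sdiff)
    (card_sdiff_eq_card_sdiff hin)
  obtain ⟨τ, k1, k2, k3⟩ := exists_perm_interchange (disjoint_sdiff_sdiff)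
    (card_sdiff_eq_card_sdiff hout)
  simp only [Finset.mem_sdiff, Finset.mem_inter, not_and, not_not] at h1 h2 h3 k1 k2 k3
  clear hs hin hout
  have hτ : ∀ a ∈ s, τ a = a := fun a ha => k3 a (by tauto) (by tauto)
  have hσ : ∀ a, a ∉ s → σ a = a := fun a ha => h3 a (by tauto) (by tauto)
  have hτs : ∀ a, a ∉ s → τ a ∉ s := fun a ha h => ha (τ.injective (hτ _ h) ▸ h)
  refine ⟨σ * τ, map_eq_of_forall_mem _ ?_ rfl, map_eq_of_forall_mem _ ?_ hc,
    map_eq_of_forall_mem _ ?_ hc.symm⟩ <;>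
  · intro a ha
    change σ (τ a) ∈ _
    by_cases has : a ∈ s
    · rw [hτ a has]
      specialize h1 a
      specialize h2 a
      specialize h3 a
      clear k1 k2 k3
      grind
    · rw [hσ _ (hτs a has)]
      specialize k1 a
      specialize k2 a
      specialize k3 a
      clear h1 h2 h3
      grind

end Permutations

/-! ### Distances in the Johnson incidence graph. -/

section Johnson

variable {Ω : Type*} [DecidableEq Ω] {m : ℕ}

/-- The automorphism of the incidence graph induced by a permutation of the points. -/
def johnsonIso (m : ℕ) (σ : Equiv.Perm Ω) :
    johnsonIncidenceGraph Ω m ≃g johnsonIncidenceGraph Ω m where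
  toEquiv := (Equiv.finsetCongr σ).subtypeEquiv fun s => by simp
  map_rel_iff' := by
    intro y z
    simp [johnsonIncidenceGraph, Equiv.finsetCongr]

/-- The distance from `x` to `y`, computed from the sets. -/
def johnsonHeight (x : Finset Ω) (y : JohnsonVertex Ω m) : ℕ :=
  2 * (x \ y.1).card + (y.1.card - m)

/-- Adding one point to a set lowers `|x \ s|` by `0` or `1`, so the height changes by exactly one
along an edge. This bounds the distance from below. -/
theorem johnsonHeight_le_of_adj (x : Finset Ω) {y z : JohnsonVertex Ω m}
    (h : (johnsonIncidenceGraph Ω m).Adj y z) :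
    johnsonHeight x z ≤ johnsonHeight x y + 1 := by
  have key : ∀ s t : Finset Ω, s ⊆ t → t.card = s.card + 1 →
      (x \ t).card ≤ (x \ s).card ∧ (x \ s).card ≤ (x \ t).card + 1 := by
    intro s t hst hc
    refine ⟨Finset.card_le_card (Finset.sdiff_subset_sdiff le_rfl hst), ?_⟩
    have hsub : x \ s ⊆ (x \ t) ∪ (t \ s) := by
      intro a; simp only [Finset.mem_sdiff, Finset.mem_union]; tauto
    have h1 := (Finset.card_le_card hsub).trans (Finset.card_union_le _ _)
    have h2 := Finset.card_sdiff_add_card_eq_card hst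
    omega
  unfold johnsonHeight
  rcases h with ⟨hy, hz, hyz⟩ | ⟨hz, hy, hzy⟩
  · have := key y.1 z.1 hyz (by omega); omega
  · have := key z.1 y.1 hzy (by omega); omega

theorem johnsonHeight_le_walk_length (x : Finset Ω) {y z : JohnsonVertex Ω m}
    (p : (johnsonIncidenceGraph Ω m).Walk y z) :
    johnsonHeight x z ≤ johnsonHeight x y + p.length := by
  induction p with
  | nil => simp
  | cons h p ih =>
    have := johnsonHeight_le_of_adj x h
    rw [SimpleGraph.Walk.length_cons]
    omega

/-- Greedy descent: an `m`-set gains a missing point of `x`, and an `(m+1)`-set, being larger than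
`x`, loses a point outside `x`. Each move lowers the height by one. -/
theorem exists_walk_length_eq_johnsonHeight (x : JohnsonVertex Ω m) (hx : x.1.card = m) (k : ℕ)
    (y : JohnsonVertex Ω m) (hy : johnsonHeight x.1 y = k) :
    ∃ p : (johnsonIncidenceGraph Ω m).Walk y x, p.length = k := by
  induction k generalizing y with
  | zero =>
    unfold johnsonHeight at hy
    have hsub : x.1 ⊆ y.1 := by
      rw [← Finset.sdiff_eq_empty_iff_subset, ← Finset.card_eq_zero]; omega
    have hyx : y = x := Subtype.ext (Finset.eq_of_subset_of_card_le hsub (by omega)).symm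
    subst hyx
    exact ⟨.nil, rfl⟩
  | succ k ih =>
    suffices h : ∃ z, (johnsonIncidenceGraph Ω m).Adj y z ∧ johnsonHeight x.1 z = k by
      obtain ⟨z, hyz, hz⟩ := h
      obtain ⟨p, hp⟩ := ih z hz
      exact ⟨.cons hyz p, by rw [SimpleGraph.Walk.length_cons, hp]⟩
    unfold johnsonHeight at hy
    rcases y.2 with hc | hc
    · obtain ⟨a, ha⟩ : (x.1 \ y.1).Nonempty := by rw [← Finset.card_pos]; omega
      have ha' := Finset.mem_sdiff.1 ha
      have hci : (insert a y.1).card = m + 1 := by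
        rw [Finset.card_insert_of_notMem ha'.2, hc]
      refine ⟨⟨insert a y.1, Or.inr hci⟩, Or.inl ⟨hc, hci, Finset.subset_insert _ _⟩, ?_⟩
      change 2 * (x.1 \ insert a y.1).card + ((insert a y.1).card - m) = k
      have herase : x.1 \ insert a y.1 = (x.1 \ y.1).erase a := by
        ext b; simp only [Finset.mem_sdiff, Finset.mem_insert, Finset.mem_erase]; tauto
      have := Finset.card_erase_add_one ha
      rw [herase, hci]
      omega
    · obtain ⟨a, ha⟩ : (y.1 \ x.1).Nonempty := by
        rw [Finset.sdiff_nonempty]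
        intro hsub
        have := Finset.card_le_card hsub
        omega
      have ha' := Finset.mem_sdiff.1 ha
      have hce : (y.1.erase a).card = m := by
        rw [Finset.card_erase_of_mem ha'.1, hc, Nat.add_sub_cancel]
      refine ⟨⟨y.1.erase a, Or.inl hce⟩, Or.inr ⟨hce, hc, Finset.erase_subset _ _⟩, ?_⟩
      change 2 * (x.1 \ y.1.erase a).card + ((y.1.erase a).card - m) = k
      have herase : x.1 \ y.1.erase a = x.1 \ y.1 := by
        ext b
        simp only [Finset.mem_sdiff, Finset.mem_erase]
        have : b = a → b ∉ x.1 := fun h => h ▸ ha'.2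
        tauto
      rw [herase, hce]
      omega

theorem johnsonIncidenceGraph_dist (x : JohnsonVertex Ω m) (hx : x.1.card = m)
    (y : JohnsonVertex Ω m) :
    (johnsonIncidenceGraph Ω m).dist x y = johnsonHeight x.1 y := by
  obtain ⟨p, hp⟩ := exists_walk_length_eq_johnsonHeight x hx _ y rfl
  refine le_antisymm ?_ ?_
  · rw [← hp, ← p.length_reverse]
    exact SimpleGraph.dist_le _
  · obtain ⟨q, hq⟩ := p.reverse.reachable.exists_walk_length_eq_dist
    have := johnsonHeight_le_walk_length x.1 q
    have h0 : johnsonHeight x.1 x = 0 := by simp [johnsonHeight, hx]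
    omega

end Johnson

end Terwilliger

theorem corollary3p5 {Ω : Type*} [Fintype Ω] [DecidableEq Ω] (n m : ℕ)
    (hΩ : Fintype.card Ω = n) (hn : 3 * m ≤ n)
    (x : Terwilliger.JohnsonVertex Ω m) (hx : x.1.card = m) :
    Terwilliger.IsThinWithRespectTo (Terwilliger.johnsonIncidenceGraph Ω m) x := by
  refine Terwilliger.isThinWithRespectTo_of_exists_iso _ x fun y z hyz => ?_
  rw [Terwilliger.johnsonIncidenceGraph_dist x hx, Terwilliger.johnsonIncidenceGraph_dist x hx]
    at hyz
  unfold Terwilliger.johnsonHeight at hyz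
  have hy := y.2
  have hz := z.2
  -- Since `|y| - m` is `0` or `1`, it is the parity of the distance; hence both summands agree for
  -- `y` and `z`.
  obtain ⟨σ, h1, h2, h3⟩ := Terwilliger.exists_perm_stabilizing (s := x.1) (y := y.1) (z := z.1)
    (by omega) (by omega)
  exact ⟨Terwilliger.johnsonIso m σ, Subtype.ext h1, Subtype.ext h2, Subtype.ext h3⟩
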